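/- Let $c>0$ and let $\varphi(r)=(r^2+c^2)^{3/2}$ be the generalised multiquadric function. Let $\gamma$ denote Euler's constant and define $$\begin{aligned} \mu_{-4}=\mu_4&=\tfrac{1}{11520}\bigl(28+60c^2+15c^4+60c^4\gamma-60c^4\log 2+60c^4\log c\bigr),\\ \mu_{-3}=\mu_3&=\tfrac{1}{480}\bigl(-16-30c^2-5c^4-20c^4\gamma+20c^4\log 2-20c^4\log c\bigr),\\ \mu_{-2}=\mu_2&=\tfrac{1}{2880}\bigl(676+780c^2+105c^4+420c^4\gamma-420c^4\log 2+420c^4\log c\bigr),\\ \mu_{-1}=\mu_1&=\tfrac{1}{1440}\bigl(-976-870c^2-105c^4-420c^4\gamma+420c^4\log 2-420c^4\log c\bigr),\\ \mu_0&=\tfrac{1}{384}\bigl(364+300c^2+35c^4+140c^4\gamma-140c^4\log 2+140c^4\log c\bigr), \end{aligned}$$ and $$\psi(x)=\sum_{k=-4}^{4}\mu_k\,\varphi(|x-k|),\qquad x\in\mathbb{R}.$$ Then quasi-interpolation with $\psi$ is exact for cubic polynomials: for every real polynomial $p$ of degree at most $3$ and every $x\in\mathbb{R}$, the series $\sum_{k\in\mathbb{Z}}p(k)\,\psi(x-k)$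 converges absolutely and $$\sum_{k\in\mathbb{Z}}p(k)\,\psi(x-k)=p(x).$$ -/

import Mathlib

noncomputable section

/-- The generalised multiquadric radial basis function `φ(r) = (r² + c²)^(3/2)`. -/
def multiquadric (c r : ℝ) : ℝ := (r ^ 2 + c ^ 2) ^ (3 / 2 : ℝ)

/-- The nine coefficients `μ₋₄, …, μ₄` (symmetric in `k`), extended by `0` to all integers;
`γ` is Euler's constant. -/
def mqCoeff (c : ℝ) (k : ℤ) : ℝ :=
  let γ := Real.eulerMascheroniConstant
  match k.natAbs with
  | 0 => (1 / 384) * (364 + 300 * c ^ 2 + 35 * c ^ 4 + 140 * c ^ 4 * γ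
      - 140 * c ^ 4 * Real.log 2 + 140 * c ^ 4 * Real.log c)
  | 1 => (1 / 1440) * (-976 - 870 * c ^ 2 - 105 * c ^ 4 - 420 * c ^ 4 * γ
      + 420 * c ^ 4 * Real.log 2 - 420 * c ^ 4 * Real.log c)
  | 2 => (1 / 2880) * (676 + 780 * c ^ 2 + 105 * c ^ 4 + 420 * c ^ 4 * γ
      - 420 * c ^ 4 * Real.log 2 + 420 * c ^ 4 * Real.log c)
  | 3 => (1 / 480) * (-16 - 30 * c ^ 2 - 5 * c ^ 4 - 20 * c ^ 4 * γ
      + 20 * c ^ 4 * Real.log 2 - 20 * c ^ 4 * Real.log c)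
  | 4 => (1 / 11520) * (28 + 60 * c ^ 2 + 15 * c ^ 4 + 60 * c ^ 4 * γ
      - 60 * c ^ 4 * Real.log 2 + 60 * c ^ 4 * Real.log c)
  | _ => 0

/-- The quasi-Lagrange function `ψ(x) = ∑_{k=-4}^{4} μ_k φ(|x - k|)`. -/
def quasiLagrange (c x : ℝ) : ℝ :=
  ∑ k ∈ Finset.Icc (-4 : ℤ) 4, mqCoeff c k * multiquadric c |x - k|

end

/-!
The quasi-Lagrange function `ψ` is a combination of five integer shifts of the fourth central
difference `D = centralDiff₄ φ` of the multiquadric `φ` (`quasiLagrange_eq`). So it is enough to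
know the moments `∑ P(x - k) D(x - k)` over `k ∈ ℤ` for cubic polynomials `P = a₀ + a₁ y + ⋯`.
They exist and equal `12 a₀ + (4 + 6 c²) a₂`, whatever the shift `x`
(`hasSum_int_cubic_mul_centralDiff₄`); inserting the Taylor coefficients of `p` at `x + j`, the
claim becomes an explicit identity for the coefficients `μ_k` of `ψ`. Their part containing `γ` and the
logarithms is a multiple of the eighth central difference, so it does not contribute and no
property of `γ` is needed.

The moments are computed without Fourier analysis. Since `φ` is even, the sum over `ℤ` splits into
two half-line sums, and on each of these `P · D` is the forward difference of an explicit
`boundaryTerm`, because the fourth difference of `P` is zero. Near `+∞` one has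
`φ(y) = y³ + 3/2 c² y + R(y)`. The polynomial part has a constant boundary term. The contribution of
`R` tends to zero: the fourth derivative of `φ` is `O(y⁻⁵)`, hence so is the fourth difference of
`R`, and since `R` tends to `0` this can be summed from infinity to give `O(y⁻¹⁻ⁱ)` for the `i`-th
difference (`isBigO_fwdDiff_iter`), while the differences of `P` grow only like `y³⁻ⁱ`. The boundary
terms at the junction of the two half-lines cancel.
-/

open Filter Topology Asymptotics fwdDiff

/-! ### Forward differences -/

/-- A discrete mean value theorem: the `n`-th forward difference with step `1` at `a` is bounded
by any bound for the `n`-th derivative on `[a, ∞)`. Here `F i` is the `i`-th derivative. -/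
lemma abs_fwdDiff_iter_le {F : ℕ → ℝ → ℝ} {B : ℝ} (n : ℕ)
    (hF : ∀ i < n, ∀ y, HasDerivAt (F i) (F (i + 1) y) y)
    {a : ℝ} (hB : ∀ y, a ≤ y → |F n y| ≤ B) : |Δ_[1] ^[n] (F 0) a| ≤ B := by
  induction n generalizing F with
  | zero => exact hB a le_rfl
  | succ n ih =>
    rw [Function.iterate_succ_apply]
    refine ih (F := fun i => Δ_[1] (F i)) (fun i hi y => ?_) fun y hy => ?_
    · exact ((hF i (by omega) (y + 1)).comp_add_const y 1).sub (hF i (by omega) y)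
    · have := (convex_Ici y).norm_image_sub_le_of_norm_hasDerivWithin_le (f := F n)
        (f' := F (n + 1)) (C := B) (x := y) (y := y + 1)
        (fun z _ => (hF n (by omega) z).hasDerivWithinAt)
        (fun z hz => hB z (hy.trans hz)) Set.self_mem_Ici (Set.mem_Ici.2 (by linarith))
      simpa [fwdDiff] using this

lemma tendsto_fwdDiff_iter {f : ℝ → ℝ} (hf : Tendsto f atTop (𝓝 0)) (i : ℕ) :
    Tendsto (Δ_[1] ^[i] f) atTop (𝓝 0) := by
  induction i with
  | zero => exact hf
  | succ i ih =>
    rw [Function.iterate_succ_apply']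
    have := (ih.comp (tendsto_atTop_add_const_right atTop (1 : ℝ) tendsto_id)).sub ih
    rw [sub_zero] at this
    exact this

/-- Summing a decay rate: a null sequence whose differences are `O(n^{-(m+1)})` is itself
`O(n^{-m})`. -/
lemma isBigO_of_isBigO_sub {a : ℕ → ℝ} {m : ℕ} (hm : m ≠ 0) (ha : Tendsto a atTop (𝓝 0))
    (hd : (fun n => a (n + 1) - a n) =O[atTop] fun n : ℕ => ((n : ℝ) ^ (m + 1))⁻¹) :
    a =O[atTop] fun n : ℕ => ((n : ℝ) ^ m)⁻¹ := by
  obtain ⟨C, hC0, hC⟩ := hd.exists_pos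
  obtain ⟨N, hN⟩ := eventually_atTop.1 hC.bound
  -- The majorant `K / n ^ m` decreases from `n` to `n + 1` by at least the bound on the difference.
  set K := C * 2 ^ m with hK
  have hK0 : 0 < K := by positivity
  have key : ∀ n : ℕ, max N 1 ≤ n →
      |a (n + 1) - a n| ≤ K * ((n : ℝ) ^ m)⁻¹ - K * (((n + 1 : ℕ) : ℝ) ^ m)⁻¹ := by
    intro n hn
    have hn1 : (1 : ℝ) ≤ n := by exact_mod_cast (le_max_right N 1).trans hn
    have h1 := hN n ((le_max_left N 1).trans hn)
    rw [Real.norm_eq_abs, Real.norm_of_nonneg (by positivity)] at h1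
    refine h1.trans ?_
    obtain ⟨k, rfl⟩ := Nat.exists_eq_succ_of_ne_zero hm
    have h2 : (n : ℝ) ^ (k + 1) + n ^ k ≤ (n + 1 : ℝ) ^ (k + 1) := by
      have : (n : ℝ) ^ k ≤ (n + 1 : ℝ) ^ k := by gcongr; linarith
      calc (n : ℝ) ^ (k + 1) + n ^ k = n ^ k * (n + 1) := by ring
        _ ≤ (n + 1 : ℝ) ^ k * (n + 1) := by gcongr
        _ = _ := by ring
    have h3 : (n + 1 : ℝ) ^ (k + 1) ≤ 2 ^ (k + 1) * n ^ (k + 1) := by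
      rw [← mul_pow]; gcongr; linarith
    push_cast
    have e : K * ((n : ℝ) ^ (k + 1))⁻¹ - K * (((n : ℝ) + 1) ^ (k + 1))⁻¹
        = K * ((n + 1 : ℝ) ^ (k + 1) - n ^ (k + 1)) / (n ^ (k + 1) * (n + 1 : ℝ) ^ (k + 1)) := by
      field_simp
    rw [Nat.succ_eq_add_one, e, ← div_eq_mul_inv, div_le_div_iff₀ (by positivity) (by positivity)]
    calc C * ((n : ℝ) ^ (k + 1) * (n + 1 : ℝ) ^ (k + 1))
        ≤ C * (n ^ (k + 1) * (2 ^ (k + 1) * n ^ (k + 1))) := by gcongr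
      _ = K * n ^ k * n ^ (k + 1 + 1) := by rw [hK, Nat.succ_eq_add_one]; ring
      _ ≤ K * ((n + 1 : ℝ) ^ (k + 1) - n ^ (k + 1)) * n ^ (k + 1 + 1) := by
        gcongr; linarith
  have hlim : Tendsto (fun n : ℕ => K * ((n : ℝ) ^ m)⁻¹) atTop (𝓝 0) := by
    simpa using ((tendsto_pow_atTop hm).comp
      (tendsto_natCast_atTop_atTop (R := ℝ))).inv_tendsto_atTop.const_mul K
  refine IsBigO.of_bound K (eventually_atTop.2 ⟨max N 1, fun n hn => ?_⟩)
  rw [Real.norm_eq_abs, Real.norm_of_nonneg (by positivity), abs_le]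
  -- `a - K / n ^ m` increases to `0` and `a + K / n ^ m` decreases to `0`.
  have up : ∀ j, a n - K * ((n : ℝ) ^ m)⁻¹
      ≤ a (n + j) - K * (((n + j : ℕ) : ℝ) ^ m)⁻¹ := by
    intro j
    induction j with
    | zero => simp
    | succ j ih =>
      have := (abs_le.1 (key (n + j) (by omega))).1
      rw [← add_assoc]; linarith
  have dn : ∀ j, a (n + j) + K * (((n + j : ℕ) : ℝ) ^ m)⁻¹ ≤ a n + K * ((n : ℝ) ^ m)⁻¹ := by
    intro j
    induction j with
    | zero => simp
    | succ j ih =>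
      have := (abs_le.1 (key (n + j) (by omega))).2
      rw [← add_assoc]; linarith
  have hshift : Tendsto (fun j => n + j) atTop atTop :=
    tendsto_atTop_mono (fun j => Nat.le_add_left j n) tendsto_id
  have h1 := ge_of_tendsto' ((ha.sub hlim).comp hshift) up
  have h2 := le_of_tendsto' ((ha.add hlim).comp hshift) dn
  constructor <;> linarith

/-- If `f` vanishes at infinity and its `N`-th difference decays at rate `N + 1`, then its `i`-th
difference decays at rate `i + 1` for every `i ≤ N`. -/
lemma isBigO_fwdDiff_iter {f : ℝ → ℝ} {N : ℕ} (hf : Tendsto f atTop (𝓝 0))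
    (hN : ∀ t : ℝ, (fun n : ℕ => Δ_[1] ^[N] f (t + n)) =O[atTop] fun n : ℕ => ((n : ℝ) ^ (N + 1))⁻¹)
    {i : ℕ} (hi : i ≤ N) (t : ℝ) :
    (fun n : ℕ => Δ_[1] ^[i] f (t + n)) =O[atTop] fun n : ℕ => ((n : ℝ) ^ (i + 1))⁻¹ := by
  induction hi using Nat.decreasingInduction with
  | self => exact hN t
  | of_succ i hi ih =>
    refine isBigO_of_isBigO_sub i.succ_ne_zero ((tendsto_fwdDiff_iter hf i).comp
      (tendsto_atTop_add_const_left atTop t tendsto_natCast_atTop_atTop)) ?_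
    simpa [Function.iterate_succ_apply', fwdDiff, add_assoc] using ih

/-! ### Summation by parts against a cubic polynomial -/

/-- The cubic polynomial function with coefficients `a₀, a₁, a₂, a₃`. -/
def cubic (a₀ a₁ a₂ a₃ y : ℝ) : ℝ := a₀ + a₁ * y + a₂ * y ^ 2 + a₃ * y ^ 3

/-- The fourth central difference of `f` with step `1`. -/
def centralDiff₄ (f : ℝ → ℝ) (y : ℝ) : ℝ := Δ_[1] ^[4] f (y - 2)

/-- The boundary term of four-fold summation by parts: its forward difference is
`P · centralDiff₄ f` when `P` is a cubic polynomial. -/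
def boundaryTerm (P f : ℝ → ℝ) (y : ℝ) : ℝ :=
  P y * Δ_[1] ^[3] f (y - 2) - Δ_[1] ^[1] P y * Δ_[1] ^[2] f (y - 1)
    + Δ_[1] ^[2] P y * Δ_[1] ^[1] f y - Δ_[1] ^[3] P y * Δ_[1] ^[0] f (y + 1)

lemma centralDiff₄_eq (f : ℝ → ℝ) (y : ℝ) :
    centralDiff₄ f y = f (y + 2) - 4 * f (y + 1) + 6 * f y - 4 * f (y - 1) + f (y - 2) := by
  simp only [centralDiff₄, fwdDiff, Function.iterate_succ, Function.iterate_zero,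
    Function.comp_apply, id]
  ring_nf

lemma centralDiff₄_neg {f : ℝ → ℝ} (hf : ∀ y, f (-y) = f y) (y : ℝ) :
    centralDiff₄ f (-y) = centralDiff₄ f y := by
  rw [centralDiff₄_eq, centralDiff₄_eq, show -y + 2 = -(y - 2) by ring,
    show -y + 1 = -(y - 1) by ring, show -y - 1 = -(y + 1) by ring,
    show -y - 2 = -(y + 2) by ring]
  simp only [hf]; ring

lemma boundaryTerm_eq (P f : ℝ → ℝ) (y : ℝ) :
    boundaryTerm P f y = P y * (f (y + 1) - 3 * f y + 3 * f (y - 1) - f (y - 2))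
      - (P (y + 1) - P y) * (f (y + 1) - 2 * f y + f (y - 1))
      + (P (y + 2) - 2 * P (y + 1) + P y) * (f (y + 1) - f y)
      - (P (y + 3) - 3 * P (y + 2) + 3 * P (y + 1) - P y) * f (y + 1) := by
  simp only [boundaryTerm, fwdDiff, Function.iterate_succ, Function.iterate_zero,
    Function.comp_apply, id]
  ring_nf

lemma boundaryTerm_sub (P f g : ℝ → ℝ) (y : ℝ) :
    boundaryTerm P (f - g) y = boundaryTerm P f y - boundaryTerm P g y := by
  simp only [boundaryTerm_eq, Pi.sub_apply]; ring

lemma boundaryTerm_add_one (a₀ a₁ a₂ a₃ : ℝ) (f : ℝ → ℝ) (y : ℝ) :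
    boundaryTerm (cubic a₀ a₁ a₂ a₃) f (y + 1) - boundaryTerm (cubic a₀ a₁ a₂ a₃) f y
      = cubic a₀ a₁ a₂ a₃ y * centralDiff₄ f y := by
  rw [boundaryTerm_eq, boundaryTerm_eq, centralDiff₄_eq,
    show y + 1 + 1 = y + 2 by ring, show y + 1 - 1 = y by ring, show y + 1 - 2 = y - 1 by ring]
  simp only [cubic]
  ring

lemma isBigO_add_natCast_pow (t : ℝ) {i d : ℕ} (hid : i ≤ d) :
    (fun n : ℕ => (t + n : ℝ) ^ i) =O[atTop] fun n : ℕ => (n : ℝ) ^ d := by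
  have h1 : (fun n : ℕ => (t + n : ℝ)) =O[atTop] fun n : ℕ => (n : ℝ) := by
    refine IsBigO.add ?_ (isBigO_refl _ _)
    exact (isLittleO_const_left.2 (Or.inr (tendsto_norm_atTop_atTop.comp
      tendsto_natCast_atTop_atTop))).isBigO
  refine (h1.pow i).trans (IsBigO.of_bound 1 (eventually_atTop.2 ⟨1, fun n hn => ?_⟩))
  have : (1 : ℝ) ≤ n := by exact_mod_cast hn
  rw [one_mul, Real.norm_of_nonneg (by positivity), Real.norm_of_nonneg (by positivity)]
  exact pow_le_pow_right₀ this hid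

lemma isBigO_cubic (a₀ a₁ a₂ a₃ t : ℝ) :
    (fun n : ℕ => cubic a₀ a₁ a₂ a₃ (t + n)) =O[atTop] fun n : ℕ => (n : ℝ) ^ 3 := by
  have h := fun i (hi : i ≤ 3) => isBigO_add_natCast_pow t hi
  have := ((((h 0 (by norm_num)).const_mul_left a₀).add ((h 1 (by norm_num)).const_mul_left a₁)).add
    ((h 2 (by norm_num)).const_mul_left a₂)).add ((h 3 le_rfl).const_mul_left a₃)
  simpa [cubic] using this

/-- Differencing lowers the growth of a cubic polynomial by one order each time. -/
lemma isBigO_fwdDiff_iter_cubic (a₀ a₁ a₂ a₃ t : ℝ) {i : ℕ} (hi : i ≤ 3) :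
    (fun n : ℕ => Δ_[1] ^[i] (cubic a₀ a₁ a₂ a₃) (t + n)) =O[atTop]
      fun n : ℕ => (n : ℝ) ^ (3 - i) := by
  have hp := fun d j (hj : j ≤ d) => isBigO_add_natCast_pow t hj
  interval_cases i
  · exact isBigO_cubic a₀ a₁ a₂ a₃ t
  · have := (((hp 2 0 (by norm_num)).const_mul_left (a₁ + a₂ + a₃)).add
      ((hp 2 1 (by norm_num)).const_mul_left (2 * a₂ + 3 * a₃))).add
      ((hp 2 2 le_rfl).const_mul_left (3 * a₃))
    refine this.congr_left fun n => ?_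
    simp only [fwdDiff, Function.iterate_succ, Function.iterate_zero, Function.comp_apply, id,
      cubic]
    ring
  · have := ((hp 1 0 (by norm_num)).const_mul_left (2 * a₂ + 6 * a₃)).add
      ((hp 1 1 le_rfl).const_mul_left (6 * a₃))
    refine this.congr_left fun n => ?_
    simp only [fwdDiff, Function.iterate_succ, Function.iterate_zero, Function.comp_apply, id,
      cubic]
    ring
  · have := (hp 0 0 le_rfl).const_mul_left (6 * a₃)
    refine this.congr_left fun n => ?_
    simp only [fwdDiff, Function.iterate_succ, Function.iterate_zero, Function.comp_apply, id,
      cubic]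
    ring

/-- The boundary term vanishes at infinity when the differences of `f` decay as for `1 / y`. -/
lemma tendsto_boundaryTerm (a₀ a₁ a₂ a₃ : ℝ) {f : ℝ → ℝ}
    (hf : ∀ i ≤ 3, ∀ t : ℝ,
      (fun n : ℕ => Δ_[1] ^[i] f (t + n)) =O[atTop] fun n : ℕ => ((n : ℝ) ^ (i + 1))⁻¹) (t : ℝ) :
    Tendsto (fun n : ℕ => boundaryTerm (cubic a₀ a₁ a₂ a₃) f (t + n)) atTop (𝓝 0) := by
  have main : ∀ i j : ℕ, i + j = 3 → ∀ s : ℝ,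
      Tendsto (fun n : ℕ => Δ_[1] ^[i] (cubic a₀ a₁ a₂ a₃) (t + n) * Δ_[1] ^[j] f (s + n))
        atTop (𝓝 0) := by
    intro i j hij s
    refine ((isBigO_fwdDiff_iter_cubic a₀ a₁ a₂ a₃ t (by omega)).mul
      (hf j (by omega) s)).trans_tendsto ?_
    refine (tendsto_inv_atTop_zero.comp
      (tendsto_natCast_atTop_atTop (R := ℝ))).congr' ?_
    filter_upwards [eventually_gt_atTop 0] with n hn
    have hn' : (n : ℝ) ≠ 0 := by positivity
    obtain rfl : j = 3 - i := by omega
    rw [Function.comp_apply, pow_succ]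
    field_simp
  have := (((main 0 3 rfl (t - 2)).sub (main 1 2 rfl (t - 1))).add (main 2 1 rfl t)).sub
    (main 3 0 rfl (t + 1))
  simp only [sub_zero, add_zero] at this
  refine this.congr fun n => ?_
  rw [boundaryTerm, show t - 2 + (n : ℝ) = t + n - 2 by ring,
    show t - 1 + (n : ℝ) = t + n - 1 by ring, show t + 1 + (n : ℝ) = t + n + 1 by ring]
  rfl

/-! ### The multiquadric -/

lemma sqrt_sq_add_sq_pos {c : ℝ} (hc : 0 < c) (y : ℝ) : 0 < √(y ^ 2 + c ^ 2) :=
  Real.sqrt_pos.2 (by positivity)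

lemma multiquadric_eq_sqrt_pow (c y : ℝ) : multiquadric c y = √(y ^ 2 + c ^ 2) ^ 3 := by
  rw [multiquadric, Real.sqrt_eq_rpow, ← Real.rpow_mul_natCast (by positivity)]
  norm_num

lemma multiquadric_neg (c y : ℝ) : multiquadric c (-y) = multiquadric c y := by
  simp [multiquadric]

lemma multiquadric_abs (c y : ℝ) : multiquadric c |y| = multiquadric c y := by
  simp [multiquadric]

/-- The multiquadric (`i = 0`) and its first four derivatives; the value for `i > 4` is a dummy. -/
noncomputable def multiquadricDeriv (c : ℝ) (i : ℕ) (y : ℝ) : ℝ :=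
  match i with
  | 0 => multiquadric c y
  | 1 => 3 * y * √(y ^ 2 + c ^ 2)
  | 2 => (6 * y ^ 2 + 3 * c ^ 2) / √(y ^ 2 + c ^ 2)
  | 3 => (6 * y ^ 3 + 9 * c ^ 2 * y) / √(y ^ 2 + c ^ 2) ^ 3
  | 4 => 9 * c ^ 4 / √(y ^ 2 + c ^ 2) ^ 5
  | _ => 0

lemma hasDerivAt_multiquadricDeriv {c : ℝ} (hc : 0 < c) {i : ℕ} (hi : i < 4) (y : ℝ) :
    HasDerivAt (multiquadricDeriv c i) (multiquadricDeriv c (i + 1) y) y := by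
  have hs0 := sqrt_sq_add_sq_pos hc y
  have hsq : √(y ^ 2 + c ^ 2) ^ 2 = y ^ 2 + c ^ 2 := Real.sq_sqrt (by positivity)
  have hs : HasDerivAt (fun y => √(y ^ 2 + c ^ 2)) (y / √(y ^ 2 + c ^ 2)) y := by
    have := ((hasDerivAt_pow 2 y).add_const (c ^ 2)).sqrt (by positivity)
    convert this using 1
    field_simp
    norm_num [mul_comm]
  have hp := fun n : ℕ => hasDerivAt_pow n y
  interval_cases i
  · have := hs.pow 3
    rw [show multiquadricDeriv c 0 = fun y => √(y ^ 2 + c ^ 2) ^ 3 from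
      funext (multiquadric_eq_sqrt_pow c)]
    refine this.congr_deriv ?_
    simp only [multiquadricDeriv]
    set s := √(y ^ 2 + c ^ 2)
    field_simp
    norm_num
    ring
  · refine (((hasDerivAt_id y).const_mul 3).mul hs).congr_deriv ?_
    simp only [multiquadricDeriv, id]
    set s := √(y ^ 2 + c ^ 2)
    field_simp
    rw [hsq]; ring
  · refine ((((hp 2).const_mul 6).add_const (3 * c ^ 2)).div hs hs0.ne').congr_deriv ?_
    simp only [multiquadricDeriv]
    set s := √(y ^ 2 + c ^ 2)
    field_simp
    rw [hsq]; push_cast; ring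
  · refine ((((hp 3).const_mul 6).add ((hasDerivAt_id y).const_mul (9 * c ^ 2))).div (hs.pow 3)
      (pow_ne_zero 3 hs0.ne')).congr_deriv ?_
    simp only [multiquadricDeriv, id]
    set s := √(y ^ 2 + c ^ 2)
    field_simp
    simp only [Pi.add_apply, Pi.pow_apply, Nat.reduceSub, Nat.cast_ofNat]
    rw [show √(y ^ 2 + c ^ 2) = s from rfl]
    linear_combination s ^ 6 * (18 * y ^ 2 + 9 * c ^ 2) * hsq

/-- The fourth derivative of the multiquadric is `9 * c ^ 4 / (y ^ 2 + c ^ 2) ^ (5 / 2)`. -/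
lemma abs_fwdDiff_multiquadric_le {c a : ℝ} (hc : 0 < c) (ha : 0 < a) :
    |Δ_[1] ^[4] (multiquadric c) a| ≤ 9 * c ^ 4 / a ^ 5 := by
  refine abs_fwdDiff_iter_le (F := multiquadricDeriv c) 4
    (fun i hi y => hasDerivAt_multiquadricDeriv hc hi y) fun y hy => ?_
  have hs0 := sqrt_sq_add_sq_pos hc y
  simp only [multiquadricDeriv]
  rw [abs_of_nonneg (by positivity)]
  have : a ≤ √(y ^ 2 + c ^ 2) := Real.le_sqrt_of_sq_le (by nlinarith)
  gcongr

/-- The polynomial part of the expansion of the multiquadric at `+∞`; the next term is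
`3 / 8 * c ^ 4 / y`. -/
noncomputable def multiquadricPoly (c y : ℝ) : ℝ := y ^ 3 + 3 / 2 * c ^ 2 * y

lemma tendsto_multiquadric_sub (c : ℝ) :
    Tendsto (multiquadric c - multiquadricPoly c) atTop (𝓝 0) := by
  have hlim : Tendsto (fun y : ℝ => 3 / 8 * c ^ 4 * y⁻¹) atTop (𝓝 0) := by
    have := (tendsto_inv_atTop_zero (𝕜 := ℝ)).const_mul (3 / 8 * c ^ 4)
    rwa [mul_zero] at this
  refine tendsto_of_tendsto_of_tendsto_of_le_of_le' tendsto_const_nhds hlim ?_ ?_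
  all_goals
    filter_upwards [eventually_gt_atTop 0] with y hy
    have hsq : (√(y ^ 2 + c ^ 2) ^ 3) ^ 2 = (y ^ 2 + c ^ 2) ^ 3 := by
      rw [← pow_mul, mul_comm 3 2, pow_mul, Real.sq_sqrt (by positivity)]
    rw [Pi.sub_apply, multiquadric_eq_sqrt_pow, multiquadricPoly]
  -- Both bounds are compared after squaring, where only powers of `y` and `c` remain.
  · rw [sub_nonneg]
    refine (pow_le_pow_iff_left₀ (by positivity) (by positivity) two_ne_zero).1 ?_
    rw [hsq]
    have : (0 : ℝ) ≤ 3 / 4 * c ^ 4 * y ^ 2 + c ^ 6 := by positivity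
    linear_combination this
  · rw [sub_le_iff_le_add]
    refine (pow_le_pow_iff_left₀ (by positivity) (by positivity) two_ne_zero).1 ?_
    rw [hsq]
    have h1 : y⁻¹ * y = 1 := inv_mul_cancel₀ hy.ne'
    have : (0 : ℝ) ≤ 1 / 8 * c ^ 6 + (3 / 8 * c ^ 4 * y⁻¹) ^ 2 := by positivity
    linear_combination this - (3 / 4 * c ^ 4 * y ^ 2 + 9 / 8 * c ^ 6) * h1

/-- The fourth difference annihilates the polynomial part, so its decay carries over. -/
lemma isBigO_fwdDiff_multiquadric_sub {c : ℝ} (hc : 0 < c) {i : ℕ} (hi : i ≤ 4) (t : ℝ) :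
    (fun n : ℕ => Δ_[1] ^[i] (multiquadric c - multiquadricPoly c) (t + n)) =O[atTop]
      fun n : ℕ => ((n : ℝ) ^ (i + 1))⁻¹ := by
  refine isBigO_fwdDiff_iter (tendsto_multiquadric_sub c) (fun t => ?_) hi t
  refine IsBigO.of_bound (9 * c ^ 4 * 2 ^ 5) ?_
  have hev : ∀ᶠ n : ℕ in atTop, 2 * |t| + 1 ≤ (n : ℝ) :=
    tendsto_natCast_atTop_atTop.eventually_ge_atTop _
  filter_upwards [hev] with n hn
  have h0 := abs_nonneg t
  have hn0 : (0 : ℝ) < n := by linarith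
  have hle : (n : ℝ) / 2 ≤ t + n := by linarith [neg_abs_le t]
  have e : Δ_[1] ^[4] (multiquadric c - multiquadricPoly c) (t + n)
      = Δ_[1] ^[4] (multiquadric c) (t + n) := by
    simp only [fwdDiff, Function.iterate_succ, Function.iterate_zero, Function.comp_apply, id,
      Pi.sub_apply, multiquadricPoly]
    ring
  rw [e, Real.norm_eq_abs, Real.norm_of_nonneg (by positivity)]
  calc _ ≤ 9 * c ^ 4 / (t + n) ^ 5 := abs_fwdDiff_multiquadric_le hc (by linarith)
    _ ≤ 9 * c ^ 4 / (n / 2 : ℝ) ^ 5 := by gcongr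
    _ = _ := by field_simp

/-- Summation by parts against the polynomial part has a constant boundary term, because its fourth
difference is zero. -/
lemma boundaryTerm_multiquadricPoly (a₀ a₁ a₂ a₃ c y : ℝ) :
    boundaryTerm (cubic a₀ a₁ a₂ a₃) (multiquadricPoly c) y
      = 6 * a₀ + (2 + 3 * c ^ 2) * a₂ := by
  simp only [boundaryTerm_eq, cubic, multiquadricPoly]; ring

/-- The sum over a half-line telescopes: the boundary term at infinity comes only from the
polynomial part of the multiquadric. -/
lemma hasSum_nat_cubic_mul_centralDiff₄ {c : ℝ} (hc : 0 < c) (a₀ a₁ a₂ a₃ t : ℝ) :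
    HasSum (fun n : ℕ => cubic a₀ a₁ a₂ a₃ (t + n) * centralDiff₄ (multiquadric c) (t + n))
      (6 * a₀ + (2 + 3 * c ^ 2) * a₂ - boundaryTerm (cubic a₀ a₁ a₂ a₃) (multiquadric c) t) := by
  have hsum : Summable
      fun n : ℕ => cubic a₀ a₁ a₂ a₃ (t + n) * centralDiff₄ (multiquadric c) (t + n) := by
    have hd : (fun n : ℕ => centralDiff₄ (multiquadric c) (t + n)) =O[atTop]
        fun n : ℕ => ((n : ℝ) ^ 5)⁻¹ := by
      refine (isBigO_fwdDiff_multiquadric_sub hc le_rfl (t - 2)).congr_left fun n => ?_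
      simp only [centralDiff₄, fwdDiff, Function.iterate_succ, Function.iterate_zero,
        Function.comp_apply, id, Pi.sub_apply, multiquadricPoly]
      ring_nf
    refine summable_of_isBigO_nat (Real.summable_nat_pow_inv.2 one_lt_two)
      (((isBigO_cubic a₀ a₁ a₂ a₃ t).mul hd).congr' EventuallyEq.rfl ?_)
    filter_upwards [eventually_gt_atTop 0] with n hn
    have hn' : (n : ℝ) ≠ 0 := by positivity
    field_simp
  rw [hsum.hasSum_iff_tendsto_nat]
  have h := (tendsto_boundaryTerm a₀ a₁ a₂ a₃
    (fun i hi t => isBigO_fwdDiff_multiquadric_sub hc (hi.trans (by norm_num)) t) t).add_const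
      (6 * a₀ + (2 + 3 * c ^ 2) * a₂ - boundaryTerm (cubic a₀ a₁ a₂ a₃) (multiquadric c) t)
  rw [zero_add] at h
  refine h.congr fun N => ?_
  rw [boundaryTerm_sub, boundaryTerm_multiquadricPoly]
  have := Finset.sum_range_sub
    (fun n : ℕ => boundaryTerm (cubic a₀ a₁ a₂ a₃) (multiquadric c) (t + n)) N
  simp only [Nat.cast_add, Nat.cast_one, ← add_assoc, boundaryTerm_add_one, Nat.cast_zero,
    add_zero] at this
  rw [this]; ring

/-- The moments of order at most `3` of the fourth difference of the multiquadric over a shifted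
integer lattice; they do not depend on the shift. -/
lemma hasSum_int_cubic_mul_centralDiff₄ {c : ℝ} (hc : 0 < c) (a₀ a₁ a₂ a₃ x : ℝ) :
    HasSum (fun k : ℤ => cubic a₀ a₁ a₂ a₃ (x - k) * centralDiff₄ (multiquadric c) (x - k))
      (12 * a₀ + (4 + 6 * c ^ 2) * a₂) := by
  rw [← (Equiv.neg ℤ).hasSum_iff]
  have h1 := hasSum_nat_cubic_mul_centralDiff₄ hc a₀ a₁ a₂ a₃ x
  -- The negative half is the half-sum of the reflected polynomial, since the multiquadric is even.
  have h2 := hasSum_nat_cubic_mul_centralDiff₄ hc a₀ (-a₁) a₂ (-a₃) (1 - x)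
  have heven := multiquadric_neg c
  have hb : boundaryTerm (cubic a₀ (-a₁) a₂ (-a₃)) (multiquadric c) (1 - x)
      = -boundaryTerm (cubic a₀ a₁ a₂ a₃) (multiquadric c) x := by
    rw [boundaryTerm_eq, boundaryTerm_eq, ← heven (1 - x + 1), ← heven (1 - x),
      ← heven (1 - x - 1), ← heven (1 - x - 2), show -(1 - x + 1) = x - 2 by ring,
      show -(1 - x) = x - 1 by ring, show -(1 - x - 1) = x by ring,
      show -(1 - x - 2) = x + 1 by ring]
    simp only [cubic]; ring
  have h : 6 * a₀ + (2 + 3 * c ^ 2) * a₂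
        - boundaryTerm (cubic a₀ a₁ a₂ a₃) (multiquadric c) x
      + (6 * a₀ + (2 + 3 * c ^ 2) * a₂
        - boundaryTerm (cubic a₀ (-a₁) a₂ (-a₃)) (multiquadric c) (1 - x))
      = 12 * a₀ + (4 + 6 * c ^ 2) * a₂ := by rw [hb]; ring
  rw [← h]
  refine HasSum.of_nat_of_neg_add_one (h1.congr_fun fun n => ?_) (h2.congr_fun fun n => ?_)
  · simp
  · have e : x - ((Equiv.neg ℤ (-((n : ℤ) + 1)) : ℤ) : ℝ) = -(1 - x + n) := by
      simp; ring
    rw [Function.comp_apply, e, centralDiff₄_neg heven]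
    congr 1
    simp only [cubic]; ring

/-! ### Polynomial reproduction -/

lemma mqCoeff_two (c : ℝ) : mqCoeff c 2 =
    (1 / 2880) * (676 + 780 * c ^ 2 + 105 * c ^ 4 + 420 * c ^ 4 * Real.eulerMascheroniConstant
      - 420 * c ^ 4 * Real.log 2 + 420 * c ^ 4 * Real.log c) := rfl

lemma mqCoeff_three (c : ℝ) : mqCoeff c 3 =
    (1 / 480) * (-16 - 30 * c ^ 2 - 5 * c ^ 4 - 20 * c ^ 4 * Real.eulerMascheroniConstant
      + 20 * c ^ 4 * Real.log 2 - 20 * c ^ 4 * Real.log c) := rfl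

lemma mqCoeff_four (c : ℝ) : mqCoeff c 4 =
    (1 / 11520) * (28 + 60 * c ^ 2 + 15 * c ^ 4 + 60 * c ^ 4 * Real.eulerMascheroniConstant
      - 60 * c ^ 4 * Real.log 2 + 60 * c ^ 4 * Real.log c) := rfl

/-- The quasi-Lagrange function is a combination of shifts of the fourth difference of the
multiquadric: the symbol `∑ μ_k z^k` is divisible by that of the fourth central difference, and the
coefficients below are those of the quotient. -/
lemma quasiLagrange_eq (c y : ℝ) : quasiLagrange c y =
    mqCoeff c 4 * centralDiff₄ (multiquadric c) (y - 2)
    + (mqCoeff c 3 + 4 * mqCoeff c 4) * centralDiff₄ (multiquadric c) (y - 1)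
    + (mqCoeff c 2 + 4 * mqCoeff c 3 + 10 * mqCoeff c 4) * centralDiff₄ (multiquadric c) y
    + (mqCoeff c 3 + 4 * mqCoeff c 4) * centralDiff₄ (multiquadric c) (y + 1)
    + mqCoeff c 4 * centralDiff₄ (multiquadric c) (y + 2) := by
  have hI : Finset.Icc (-4 : ℤ) 4 = {-4, -3, -2, -1, 0, 1, 2, 3, 4} := by decide
  simp only [quasiLagrange, multiquadric_abs, hI, centralDiff₄_eq]
  simp [mqCoeff]
  ring_nf

theorem mainTheorem2 (c : ℝ) (hc : 0 < c) (p : Polynomial ℝ) (hp : p.natDegree ≤ 3) (x : ℝ) :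
    HasSum (fun k : ℤ => p.eval (k : ℝ) * quasiLagrange c (x - k)) (p.eval x) := by
  have hpe : ∀ y, p.eval y
      = cubic (p.coeff 0) (p.coeff 1) (p.coeff 2) (p.coeff 3) y := by
    intro y
    rw [Polynomial.eval_eq_sum_range' (Nat.lt_succ_of_le hp)]
    simp [Finset.sum_range_succ, cubic]
  generalize p.coeff 0 = p₀ at hpe
  generalize p.coeff 1 = p₁ at hpe
  generalize p.coeff 2 = p₂ at hpe
  generalize p.coeff 3 = p₃ at hpe
  simp only [hpe]
  -- With `z = x + j - k`, the Taylor expansion of `p (k) = p (x + j - z)` in powers of `z`.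
  have key : ∀ j : ℝ, HasSum (fun k : ℤ => cubic p₀ p₁ p₂ p₃ k *
      centralDiff₄ (multiquadric c) (x - k + j))
      (12 * cubic p₀ p₁ p₂ p₃ (x + j) + (4 + 6 * c ^ 2) * (p₂ + 3 * p₃ * (x + j))) := by
    intro j
    have := hasSum_int_cubic_mul_centralDiff₄ hc (cubic p₀ p₁ p₂ p₃ (x + j))
      (-(p₁ + 2 * p₂ * (x + j) + 3 * p₃ * (x + j) ^ 2)) (p₂ + 3 * p₃ * (x + j)) (-p₃) (x + j)
    refine this.congr_fun fun k => ?_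
    rw [show x - k + j = x + j - (k : ℝ) by ring]
    congr 1
    simp only [cubic]; ring
  have := (((((key (-2)).mul_left (mqCoeff c 4)).add
    ((key (-1)).mul_left (mqCoeff c 3 + 4 * mqCoeff c 4))).add
    ((key 0).mul_left (mqCoeff c 2 + 4 * mqCoeff c 3 + 10 * mqCoeff c 4))).add
    ((key 1).mul_left (mqCoeff c 3 + 4 * mqCoeff c 4))).add ((key 2).mul_left (mqCoeff c 4))
  have hval : ∀ {f : ℤ → ℝ} {s t : ℝ}, HasSum f s → s = t → HasSum f t := fun h e => e ▸ h
  refine hval (this.congr_fun fun k => ?_) ?_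
  · rw [quasiLagrange_eq, ← sub_eq_add_neg, ← sub_eq_add_neg, add_zero]
    ring
  -- The `γ` and logarithm parts of the coefficients are an eighth difference, which cancels here.
  · simp only [cubic, mqCoeff_two, mqCoeff_three, mqCoeff_four]
    ring
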